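/- Fix $\alpha>1$, $C_0>0$ and $c_1,c_2>0$. Then there is a constant $C>0$, depending only on $\alpha,C_0,c_1,c_2$ (in particular independent of $n$, $\lambda$ and $\sigma$), such that the following holds. Let $n\ge 1$, let $A\in\mathbb{R}^{n\times n}$, let $W\in\mathbb{R}^{n\times n}$ be symmetric positive definite, and write $(x,y)_W=x^\top W y$, $\|x\|_W^2=(x,x)_W$; $\|\cdot\|$ is the Euclidean norm. Suppose that the eigenvalues $\rho_1\ge\rho_2\ge\dots\ge\rho_n$ (counted with multiplicity) of the generalized eigenvalue problem $(A\psi,Au)=\rho\,(\psi,u)_W$ for all $u\in\mathbb{R}^n$ satisfy $\rho_k\le C_0k^{-\alpha}$ for $k=1,\dots,n$. Let $x^*\in\mathbb{R}^n$ and $\sigma>0$, and let $b=Ax^*+e$, where $e=(e_1,\dots,e_n)$ has independent entries with $\mathbb{E}[e_i]=0$ and $\mathbb{E}[\exp(t(e_i-\mathbb{E}[e_i]))]\le\exp(\tfrac12\sigma^2t^2)$ for all $t\in\mathbb{R}$. For $\lambda>0$ let $x_\lambda$ be the minimizer over $x\in\mathbb{R}^n$ of $\|Ax-b\|^2+\lambda\|x\|_W^2$.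 Put $$\rho_0=\frac1{\sqrt n}\|x^*\|_W+\sigma n^{-1/2},\qquad B=(W^{-1/2}A^\top AW^{-1/2})^{1/4}W^{1/2},$$ and suppose that $\lambda$ is chosen of the order $$c_1\,\sigma n^{-1/2}\rho_0^{-1}\le\lambda^{\frac12+\frac1{2\alpha}}\le c_2\,\sigma n^{-1/2}\rho_0^{-1}.$$ Then, for all $z\ge 0$, $$\mathbb{P}\Big(\frac1{\sqrt n}\|B(x_\lambda-x^*)\|\ge\lambda^{1/4}\rho_0z\Big)\le 2e^{-Cz^2}.$$ -/

import Mathlib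

open MeasureTheory ProbabilityTheory

noncomputable section

namespace WTikhonov

/-- `ℝⁿ` with the Euclidean norm. -/
abbrev Vec (n : ℕ) : Type := EuclideanSpace ℝ (Fin n)

/-- The product `A x` of a matrix and a vector. -/
def app {n : ℕ} (A : Matrix (Fin n) (Fin n) ℝ) (x : Vec n) : Vec n :=
  Matrix.toEuclideanLin A x

/-- `(x, y)_W = xᵀ W y`. -/
def wInner {n : ℕ} (W : Matrix (Fin n) (Fin n) ℝ) (x y : Vec n) : ℝ :=
  inner ℝ x (app W y)

/-- `‖x‖_W = (xᵀ W x)^{1/2}`. -/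
def wNorm {n : ℕ} (W : Matrix (Fin n) (Fin n) ℝ) (x : Vec n) : ℝ :=
  Real.sqrt (wInner W x x)

/-- `ρ 0 ≥ ρ 1 ≥ ⋯` is the list of all eigenvalues, repeated according to multiplicity, of the
generalized eigenvalue problem `(A ψ, A u) = ρ (ψ, u)_W` for all `u`: there is a basis of `ℝⁿ`
whose `k`-th vector is an eigenvector for `ρ k`. When `W` is symmetric positive definite there is
exactly one such list. -/
def IsGenEigenvalues {n : ℕ} (A W : Matrix (Fin n) (Fin n) ℝ) (ρ : Fin n → ℝ) : Prop :=
  Antitone ρ ∧ ∃ ψ : Module.Basis (Fin n) ℝ (Vec n), ∀ (k : Fin n) (u : Vec n),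
    inner ℝ (app A (ψ k)) (app A u) = ρ k * wInner W (ψ k) u

/-- The generalized eigenvalues decay polynomially: `ρ_k ≤ C₀ k^{-α}` for `k = 1, …, n`
(the entry with index `k : Fin n` is the `(k+1)`-st eigenvalue). -/
def EigenvalueDecay {n : ℕ} (A W : Matrix (Fin n) (Fin n) ℝ) (C₀ α : ℝ) : Prop :=
  ∀ ρ : Fin n → ℝ, IsGenEigenvalues A W ρ →
    ∀ k : Fin n, ρ k ≤ C₀ * (((k : ℕ) : ℝ) + 1) ^ (-α)

/-- The weighted Tikhonov functional `x ↦ ‖A x - b‖² + lam ‖x‖_W²`. -/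
def tikhonov {n : ℕ} (A W : Matrix (Fin n) (Fin n) ℝ) (b : Vec n) (lam : ℝ) (x : Vec n) : ℝ :=
  ‖app A x - b‖ ^ 2 + lam * wNorm W x ^ 2

/-- `x` minimizes the weighted Tikhonov functional over `ℝⁿ`. -/
def IsTikhonovSolution {n : ℕ} (A W : Matrix (Fin n) (Fin n) ℝ) (b : Vec n) (lam : ℝ)
    (x : Vec n) : Prop :=
  ∀ y : Vec n, tikhonov A W b lam x ≤ tikhonov A W b lam y

/-- `ρ₀ = n^{-1/2} ‖x*‖_W + σ n^{-1/2}`. -/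
def rhoZero {n : ℕ} (W : Matrix (Fin n) (Fin n) ℝ) (xs : Vec n) (σ : ℝ) : ℝ :=
  1 / Real.sqrt n * wNorm W xs + σ * (n : ℝ) ^ (-(1 / 2) : ℝ)

open scoped MatrixOrder in
/-- `B = (W^{-1/2} Aᵀ A W^{-1/2})^{1/4} W^{1/2}`; the powers are those of positive (semi)definite
symmetric matrices, given by the functional calculus. -/
def weakOp {n : ℕ} (A W : Matrix (Fin n) (Fin n) ℝ) : Matrix (Fin n) (Fin n) ℝ :=
  (W ^ (-(1 / 2) : ℝ) * A.transpose * A * W ^ (-(1 / 2) : ℝ)) ^ (1 / 4 : ℝ) * W ^ (1 / 2 : ℝ)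

/-- Independent, centred, sub-Gaussian random variables with parameter `σ`:
`E[e i] = 0` and `E[exp (t (e i - E[e i]))] ≤ exp (σ² t² / 2)` for all real `t`. -/
structure IsSubGaussianNoise {n : ℕ} {Ω : Type*} [MeasurableSpace Ω] (P : Measure Ω)
    (e : Fin n → Ω → ℝ) (σ : ℝ) : Prop where
  measurable : ∀ i, Measurable (e i)
  indep : iIndepFun e P
  centred : ∀ i, ∫ ω, e i ω ∂P = 0
  subGaussian : ∀ i, HasSubgaussianMGF (fun ω => e i ω - ∫ ω', e i ω' ∂P) (σ.toNNReal ^ 2) P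

end WTikhonov

end

namespace WTikhonov

/-! A `W`-orthonormal basis ψ_k diagonalizes both forms (`exists_genEigenbasis`), and ‖Bx‖² becomes
∑ ρ_k^{1/2} (ψ_k, x)_W². In these coordinates the Euler equation reads (ρ_k + λ) y_k = √ρ_k X_k - λ
s_k, where y, s are the coordinates of the error and of x*, and X_k is the noise along the
normalized A ψ_k. Hence (`exists_error_bound`) ‖B(x_λ - x*)‖² is at most 2Q + 2√λ‖x*‖_W², with Q =
λ^{-1/2} ∑ ρ_k/(ρ_k+λ) X_k². The bias is at most 2√λ n ρ₀².

Each X_k is sub-Gaussian with parameter σ, so Q has an exponential tail at scale σ² times its total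
weight (`measureReal_sum_sq_ge_le`). Eigenvalue decay bounds ∑ ρ_k/(ρ_k+λ) by a multiple of
λ^{-1/α}, and the lower bound on λ turns the resulting exponent into a multiple of z². -/

lemma app_mul {n : ℕ} (M N : Matrix (Fin n) (Fin n) ℝ) (x : Vec n) :
    app (M * N) x = app M (app N x) := by
  simp [app, Matrix.toLpLin_apply, Matrix.mulVec_mulVec]

lemma app_one {n : ℕ} (x : Vec n) : app 1 x = x := by
  simp [app]

lemma app_add {n : ℕ} (M : Matrix (Fin n) (Fin n) ℝ) (x y : Vec n) :
    app M (x + y) = app M x + app M y := map_add _ _ _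

lemma app_sub {n : ℕ} (M : Matrix (Fin n) (Fin n) ℝ) (x y : Vec n) :
    app M (x - y) = app M x - app M y := map_sub _ _ _

lemma app_smul {n : ℕ} (M : Matrix (Fin n) (Fin n) ℝ) (c : ℝ) (x : Vec n) :
    app M (c • x) = c • app M x := map_smul _ _ _

lemma inner_app_transpose {n : ℕ} (M : Matrix (Fin n) (Fin n) ℝ) (x y : Vec n) :
    inner ℝ x (app M.transpose y) = inner ℝ (app M x) y := by
  have h : Matrix.toEuclideanLin M.transpose = (Matrix.toEuclideanLin M).adjoint := by
    rw [← Matrix.conjTranspose_eq_transpose_of_trivial,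
      Matrix.toEuclideanLin_conjTranspose_eq_adjoint]
  simp only [app, h, LinearMap.adjoint_inner_right]

/-! ### Spectral decomposition and Euler equation -/

lemma cfc_mulVec_eigenvectorBasis {n : ℕ} {T : Matrix (Fin n) (Fin n) ℝ} (hT : T.IsHermitian)
    (f : ℝ → ℝ) (j : Fin n) :
    app (cfc f T) (hT.eigenvectorBasis j) = f (hT.eigenvalues j) • hT.eigenvectorBasis j := by
  have h : (cfc f T).mulVec (hT.eigenvectorBasis j).ofLp
      = f (hT.eigenvalues j) • (hT.eigenvectorBasis j).ofLp := by
    rw [hT.cfc_eq, Matrix.IsHermitian.cfc, Unitary.conjStarAlgAut_apply, ← Matrix.mulVec_mulVec,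
      ← Matrix.mulVec_mulVec]
    erw [hT.star_eigenvectorUnitary_mulVec]
    rw [Matrix.diagonal_mulVec_single]
    have : (Pi.single j (((RCLike.ofReal : ℝ → ℝ) ∘ f ∘ hT.eigenvalues) j * 1) : Fin n → ℝ)
        = f (hT.eigenvalues j) • Pi.single j 1 := by
      rw [← Pi.single_smul]; simp
    rw [this, Matrix.mulVec_smul, hT.eigenvectorUnitary_mulVec]
  ext i
  simpa [app, Matrix.toLpLin_apply] using congrFun h i

open scoped MatrixOrder in
/-- Simultaneous diagonalization of `(A ·, A ·)` and `(·, ·)_W`, in sorted order. -/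
theorem exists_genEigenbasis {n : ℕ} (A W : Matrix (Fin n) (Fin n) ℝ) (hW : W.PosDef) :
    ∃ (ρ : Fin n → ℝ) (ψ : Fin n → Vec n), IsGenEigenvalues A W ρ ∧ (∀ k, 0 ≤ ρ k) ∧
      (∀ k u, inner ℝ (app A (ψ k)) (app A u) = ρ k * wInner W (ψ k) u) ∧
      (∀ k, wInner W (ψ k) (ψ k) = 1) ∧
      (∀ x, wNorm W x ^ 2 = ∑ k, wInner W (ψ k) x ^ 2) ∧
      (∀ x, ‖app (weakOp A W) x‖ ^ 2 = ∑ k, ρ k ^ (1 / 2 : ℝ) * wInner W (ψ k) x ^ 2) := by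
  set S : Matrix (Fin n) (Fin n) ℝ := W ^ (1 / 2 : ℝ) with hS
  set R : Matrix (Fin n) (Fin n) ℝ := W ^ (-(1 / 2) : ℝ) with hR
  have hWs : IsStrictlyPositive W := Matrix.isStrictlyPositive_iff_posDef.2 hW
  have hSR : S * R = 1 := CFC.rpow_mul_rpow_neg _ hWs
  have hRS : R * S = 1 := CFC.rpow_neg_mul_rpow _ hWs
  have hSS : S * S = W := by
    rw [hS, ← CFC.rpow_add hWs.isUnit]
    norm_num
    exact CFC.rpow_one W hWs.nonneg
  have hSt : S.transpose = S := by
    have : (0 : Matrix (Fin n) (Fin n) ℝ) ≤ S := CFC.rpow_nonneg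
    simpa using (Matrix.nonneg_iff_posSemidef.1 this).isHermitian.eq
  have hRt : R.transpose = R := by
    have : (0 : Matrix (Fin n) (Fin n) ℝ) ≤ R := CFC.rpow_nonneg
    simpa using (Matrix.nonneg_iff_posSemidef.1 this).isHermitian.eq
  set T : Matrix (Fin n) (Fin n) ℝ := R * A.transpose * A * R with hTdef
  have hTpsd : T.PosSemidef := by
    have := Matrix.posSemidef_conjTranspose_mul_self (A * R)
    rwa [Matrix.conjTranspose_eq_transpose_of_trivial, Matrix.transpose_mul, hRt,
      ← Matrix.mul_assoc] at this
  have hT := hTpsd.isHermitian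
  -- Sorting the negatives gives the decreasing order required by `IsGenEigenvalues`.
  let τ : Equiv.Perm (Fin n) := Tuple.sort (fun i => -hT.eigenvalues i)
  let v : OrthonormalBasis (Fin n) ℝ (Vec n) := hT.eigenvectorBasis.reindex τ.symm
  let ρ : Fin n → ℝ := fun k => hT.eigenvalues (τ k)
  have hv : ∀ k, v k = hT.eigenvectorBasis (τ k) := fun k => by simp [v]
  have hTv : ∀ k, app T (v k) = ρ k • v k := fun k => by
    ext i
    rw [hv]
    simpa [app, Matrix.toLpLin_apply, ρ] using congrFun (hT.mulVec_eigenvectorBasis (τ k)) i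
  have hT4v : ∀ k, app (T ^ (1 / 4 : ℝ)) (v k) = ρ k ^ (1 / 4 : ℝ) • v k := fun k => by
    rw [CFC.rpow_eq_cfc_real hTpsd.nonneg, hv]
    exact cfc_mulVec_eigenvectorBasis hT _ (τ k)
  have hT4t : (T ^ (1 / 4 : ℝ)).transpose = T ^ (1 / 4 : ℝ) := by
    have : (0 : Matrix (Fin n) (Fin n) ℝ) ≤ T ^ (1 / 4 : ℝ) := CFC.rpow_nonneg
    simpa using (Matrix.nonneg_iff_posSemidef.1 this).isHermitian.eq
  have hρ : ∀ k, 0 ≤ ρ k := fun k => hTpsd.eigenvalues_nonneg _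
  have hanti : Antitone ρ := fun i j hij => by
    have := Tuple.monotone_sort (fun i => -hT.eigenvalues i) hij
    simpa [ρ, τ] using this
  let ψ : Fin n → Vec n := fun k => app R (v k)
  have hSψ : ∀ k, app S (ψ k) = v k := fun k => by
    simp only [ψ, ← app_mul, hSR, app_one]
  have hinner : ∀ x y, wInner W x y = inner ℝ (app S x) (app S y) := fun x y => by
    rw [wInner, ← hSS, app_mul, ← inner_app_transpose, hSt]
  have hψ : ∀ k x, wInner W (ψ k) x = inner ℝ (v k) (app S x) := fun k x => by
    rw [hinner, hSψ]
  have hgen : ∀ k u, inner ℝ (app A (ψ k)) (app A u) = ρ k * wInner W (ψ k) u := fun k u => by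
    have hu : u = app R (app S u) := by rw [← app_mul, hRS, app_one]
    calc inner ℝ (app A (ψ k)) (app A u)
        = inner ℝ (v k) (app T (app S u)) := by
          conv_lhs => rw [hu]
          rw [← inner_app_transpose]
          conv_lhs => rw [← inner_app_transpose R, hRt]
          simp only [T, app_mul]
      _ = inner ℝ (app T (v k)) (app S u) := by
          rw [← inner_app_transpose]
          congr 2
          simpa using hT.eq.symm
      _ = ρ k * wInner W (ψ k) u := by rw [hTv, inner_smul_left, hψ]; simp
  let Re : Vec n ≃ₗ[ℝ] Vec n := LinearEquiv.ofLinearMap (Matrix.toEuclideanLin R)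
    (Matrix.toEuclideanLin S)
    (by ext1 x; exact (app_mul R S x).symm.trans (by rw [hRS, app_one]; rfl))
    (by ext1 x; exact (app_mul S R x).symm.trans (by rw [hSR, app_one]; rfl))
  refine ⟨ρ, ψ, ⟨hanti, v.toBasis.map Re, fun k u => ?_⟩, hρ, hgen, fun k => ?_, fun x => ?_,
    fun x => ?_⟩
  · have : (v.toBasis.map Re) k = ψ k := by simp [Re, ψ, app]
    rw [this, hgen]
  · rw [hψ, hSψ, real_inner_self_eq_norm_sq, v.norm_eq_one]; norm_num
  · rw [wNorm, Real.sq_sqrt, hinner, real_inner_self_eq_norm_sq, ← v.sum_sq_norm_inner_right]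
    · simp [hψ]
    · rw [hinner]; exact real_inner_self_nonneg
  · rw [← v.sum_sq_norm_inner_right]
    refine Finset.sum_congr rfl fun k _ => ?_
    have : app (weakOp A W) x = app (T ^ (1 / 4 : ℝ)) (app S x) := app_mul _ _ _
    rw [this, ← hT4t, inner_app_transpose, hT4v, inner_smul_left, hψ, Real.norm_eq_abs, sq_abs,
      mul_pow]
    congr 1
    rw [conj_trivial, ← Real.rpow_natCast, ← Real.rpow_mul (hρ k)]
    norm_num

/-- Euler equation of the weighted Tikhonov functional. -/
theorem IsTikhonovSolution.euler {n : ℕ} {A W : Matrix (Fin n) (Fin n) ℝ} (hW : W.PosDef)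
    {b x : Vec n} {lam : ℝ} (hx : IsTikhonovSolution A W b lam x) (u : Vec n) :
    inner ℝ (app A u) (app A x - b) + lam * wInner W u x = 0 := by
  have hpos : ∀ y : Vec n, 0 ≤ wInner W y y := fun y => by
    have := hW.posSemidef.dotProduct_mulVec_nonneg y.ofLp
    simpa [wInner, app, Matrix.toLpLin_apply, PiLp.inner_apply, dotProduct, mul_comm] using this
  have hsymm : wInner W x u = wInner W u x := by
    have : W.transpose = W := by simpa using hW.isHermitian.eq
    rw [wInner, ← this, inner_app_transpose, real_inner_comm, wInner, this]
  -- A nonnegative quadratic in t without constant term has zero linear coefficient: its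
  -- discriminant is that coefficient squared.
  have key : ∀ t : ℝ, 0 ≤ (‖app A u‖ ^ 2 + lam * wInner W u u) * (t * t)
      + 2 * (inner ℝ (app A u) (app A x - b) + lam * wInner W u x) * t + 0 := fun t => by
    have h := hx (x + t • u)
    have h1 : app A (x + t • u) - b = (app A x - b) + t • app A u := by
      rw [app_add, app_smul]; abel
    have h2 : wInner W (x + t • u) (x + t • u)
        = wInner W x x + 2 * t * wInner W u x + t ^ 2 * wInner W u u := by
      simp only [wInner] at hsymm ⊢
      simp only [app_add, app_smul, inner_add_left, inner_add_right, inner_smul_left,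
        inner_smul_right, hsymm, conj_trivial]
      ring
    rw [tikhonov, tikhonov, wNorm, wNorm, Real.sq_sqrt (hpos _), Real.sq_sqrt (hpos _), h1, h2,
      norm_add_sq_real, norm_smul, inner_smul_right, mul_pow, Real.norm_eq_abs, sq_abs,
      real_inner_comm] at h
    nlinarith [h]
  have := discrim_le_zero key
  rw [discrim] at this
  nlinarith [sq_nonneg (inner ℝ (app A u) (app A x - b) + lam * wInner W u x)]

/-! ### Sub-Gaussian quadratic tails -/

/-- The factor exp(g²/4) turns the N(0,1) density into √2 times the N(0,2) density. -/
lemma lintegral_exp_sq_gaussianReal :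
    ∫⁻ g, ENNReal.ofReal (Real.exp (g ^ 2 / 4)) ∂(gaussianReal 0 1) ≤ 2 := by
  have h : ∀ g : ℝ, gaussianPDF 0 1 g * ENNReal.ofReal (Real.exp (g ^ 2 / 4))
      = ENNReal.ofReal √2 * gaussianPDF 0 2 g := fun g => by
    rw [gaussianPDF, gaussianPDF, ← ENNReal.ofReal_mul (gaussianPDFReal_nonneg _ _ _),
      ← ENNReal.ofReal_mul (by positivity)]
    congr 1
    simp only [gaussianPDFReal, sub_zero, NNReal.coe_one, NNReal.coe_ofNat, mul_one]
    rw [mul_assoc, ← Real.exp_add, show 2 * Real.pi * 2 = 2 * (2 * Real.pi) by ring,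
      Real.sqrt_mul (by norm_num : (0 : ℝ) ≤ 2) (2 * Real.pi), mul_inv, ← mul_assoc, ← mul_assoc,
      mul_inv_cancel₀ (by positivity), one_mul]
    congr 2
    ring
  rw [gaussianReal_of_var_ne_zero _ one_ne_zero, lintegral_withDensity_eq_lintegral_mul _
    (measurable_gaussianPDF _ _) (by fun_prop)]
  simp only [Pi.mul_apply, h]
  rw [lintegral_const_mul _ (measurable_gaussianPDF _ _),
    lintegral_gaussianPDF_eq_one _ two_ne_zero, mul_one, ENNReal.ofReal_le_ofNat,
    Real.sqrt_le_left (by norm_num)]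
  norm_num

/-- The exponential square moment of a sub-Gaussian random variable. -/
theorem lintegral_exp_sq_le {Ω : Type*} [MeasurableSpace Ω] {P : Measure Ω}
    [IsProbabilityMeasure P] {X : Ω → ℝ} (hXm : Measurable X) {v : NNReal}
    (hX : HasSubgaussianMGF X v P) {c : ℝ} (hc : 0 ≤ c) (hcv : 4 * c * v ≤ 1) :
    ∫⁻ ω, ENNReal.ofReal (Real.exp (c * X ω ^ 2)) ∂P ≤ 2 := by
  -- An auxiliary Gaussian g linearizes the square; after Tonelli, the moment generating function of
  -- X gives exp(c v g²) ≤ exp(g²/4).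
  have h1 : ∀ ω, ENNReal.ofReal (Real.exp (c * X ω ^ 2))
      = ∫⁻ g, ENNReal.ofReal (Real.exp (√(2 * c) * X ω * g)) ∂(gaussianReal 0 1) := fun ω => by
    rw [← ofReal_integral_eq_lintegral_ofReal]
    · have := congrFun (mgf_id_gaussianReal (μ := 0) (v := 1)) (√(2 * c) * X ω)
      simp only [mgf, id] at this
      rw [this, mul_pow, Real.sq_sqrt (by positivity)]
      congr 2
      simp; ring
    · exact integrable_exp_mul_gaussianReal _
    · exact Filter.Eventually.of_forall fun g => (Real.exp_pos _).le
  have h2 : ∀ g, ∫⁻ ω, ENNReal.ofReal (Real.exp (√(2 * c) * X ω * g)) ∂P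
      ≤ ENNReal.ofReal (Real.exp (g ^ 2 / 4)) := fun g => by
    have h : ∀ ω, √(2 * c) * X ω * g = (√(2 * c) * g) * X ω := fun ω => by ring
    simp only [h]
    rw [← ofReal_integral_eq_lintegral_ofReal (hX.integrable_exp_mul _)
      (Filter.Eventually.of_forall fun g => (Real.exp_pos _).le)]
    refine ENNReal.ofReal_le_ofReal ((hX.mgf_le _).trans (Real.exp_le_exp.2 ?_))
    rw [mul_pow, Real.sq_sqrt (by positivity)]
    nlinarith [mul_le_mul_of_nonneg_right hcv (sq_nonneg g)]
  simp only [h1]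
  rw [lintegral_lintegral_swap (by fun_prop)]
  exact (lintegral_mono h2).trans lintegral_exp_sq_gaussianReal

/-- Tail bound for a weighted sum of squares of (possibly dependent) sub-Gaussian variables. -/
theorem measureReal_sum_sq_ge_le {Ω : Type*} [MeasurableSpace Ω] {P : Measure Ω}
    [IsProbabilityMeasure P] {ι : Type*} [Fintype ι] {X : ι → Ω → ℝ}
    (hXm : ∀ i, Measurable (X i)) {σ : ℝ} (hσ : 0 < σ)
    (hX : ∀ i, HasSubgaussianMGF (X i) (σ.toNNReal ^ 2) P) {w : ι → ℝ} (hw : ∀ i, 0 ≤ w i)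
    (hw0 : 0 < ∑ i, w i) (s : ℝ) :
    P.real {ω | s ≤ ∑ i, w i * X i ω ^ 2} ≤ 2 * Real.exp (-(s / (4 * σ ^ 2 * ∑ i, w i))) := by
  set τ := ∑ i, w i with hτ
  set c : ℝ := 1 / (4 * σ ^ 2) with hc
  have hc0 : 0 < c := by positivity
  let F : Ω → ENNReal := fun ω => ∑ i, ENNReal.ofReal (w i / τ)
    * ENNReal.ofReal (Real.exp (c * X i ω ^ 2))
  have hFint : ∫⁻ ω, F ω ∂P ≤ 2 := by
    rw [lintegral_finsetSum _ fun i _ => by have := hXm i; fun_prop]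
    calc ∑ i, ∫⁻ ω, ENNReal.ofReal (w i / τ) * ENNReal.ofReal (Real.exp (c * X i ω ^ 2)) ∂P
        ≤ ∑ i, ENNReal.ofReal (w i / τ) * 2 := by
          refine Finset.sum_le_sum fun i _ => ?_
          rw [lintegral_const_mul _ (by have := hXm i; fun_prop)]
          gcongr
          refine lintegral_exp_sq_le (hXm i) (hX i) hc0.le (le_of_eq ?_)
          rw [hc]; push_cast; rw [Real.coe_toNNReal _ hσ.le]; field_simp
      _ = 2 := by
          rw [← Finset.sum_mul, ← ENNReal.ofReal_sum_of_nonneg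
            (fun i _ => div_nonneg (hw i) hw0.le), ← Finset.sum_div, div_self hw0.ne']
          simp
  have hsub : ∀ ω, s ≤ ∑ i, w i * X i ω ^ 2 →
      ENNReal.ofReal (Real.exp (s / (4 * σ ^ 2 * τ))) ≤ F ω := fun ω hω => by
    -- Jensen with normalized weights replaces independence of the `X i`.
    have hj := convexOn_exp.map_sum_le (t := Finset.univ) (w := fun i => w i / τ)
      (p := fun i => c * X i ω ^ 2) (fun i _ => div_nonneg (hw i) hw0.le)
      (by rw [← Finset.sum_div, div_self hw0.ne']) (fun _ _ => Set.mem_univ _)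
    have hF : F ω = ENNReal.ofReal (∑ i, w i / τ * Real.exp (c * X i ω ^ 2)) := by
      rw [ENNReal.ofReal_sum_of_nonneg
        (fun i _ => mul_nonneg (div_nonneg (hw i) hw0.le) (Real.exp_pos _).le)]
      exact Finset.sum_congr rfl fun i _ =>
        (ENNReal.ofReal_mul (div_nonneg (hw i) hw0.le)).symm
    rw [hF]
    refine ENNReal.ofReal_le_ofReal (le_trans (Real.exp_le_exp.2 ?_) hj)
    have : ∑ i, (w i / τ) • (c * X i ω ^ 2) = c / τ * ∑ i, w i * X i ω ^ 2 := by
      rw [Finset.mul_sum]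
      exact Finset.sum_congr rfl fun i _ => by simp only [smul_eq_mul]; ring
    rw [this]
    calc s / (4 * σ ^ 2 * τ) = c / τ * s := by rw [hc]; field_simp
      _ ≤ _ := by gcongr
  have hmarkov : ENNReal.ofReal (Real.exp (s / (4 * σ ^ 2 * τ)))
      * P {ω | s ≤ ∑ i, w i * X i ω ^ 2} ≤ 2 := by
    refine le_trans ?_ ((mul_meas_ge_le_lintegral (μ := P) (f := F) ?_
      (ENNReal.ofReal (Real.exp (s / (4 * σ ^ 2 * τ))))).trans hFint)
    · gcongr
      exact fun h => hsub _ h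
    · exact Finset.measurable_sum _ fun i _ => by have := hXm i; fun_prop
  have hreal := ENNReal.toReal_mono (by simp) hmarkov
  rw [ENNReal.toReal_mul, ENNReal.toReal_ofReal (Real.exp_pos _).le] at hreal
  rw [Real.exp_neg, ← div_eq_mul_inv, le_div_iff₀ (Real.exp_pos _), mul_comm]
  simpa [Measure.real] using hreal

/-- Linear functionals of sub-Gaussian noise are sub-Gaussian. -/
theorem IsSubGaussianNoise.hasSubgaussianMGF_inner {n : ℕ} {Ω : Type*} [MeasurableSpace Ω] {P : Measure Ω}
    [IsProbabilityMeasure P] {e : Fin n → Ω → ℝ} {σ : ℝ} (he : IsSubGaussianNoise P e σ)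
    (u : Vec n) (hu : ‖u‖ ≤ 1) :
    HasSubgaussianMGF (fun ω => inner ℝ u (WithLp.toLp 2 (fun i => e i ω))) (σ.toNNReal ^ 2) P := by
  have h1 : ∀ i, HasSubgaussianMGF (fun ω => u i * e i ω)
      (.mk (u i ^ 2) (sq_nonneg _) * σ.toNNReal ^ 2) P := fun i => by
    have := he.subGaussian i
    simp only [he.centred i, sub_zero] at this
    exact this.const_mul (u i)
  have hind : iIndepFun (fun i ω => u i * e i ω) P :=
    he.indep.comp (fun i x => u i * x) (fun i => by fun_prop)
  have h2 := HasSubgaussianMGF.sum_of_iIndepFun hind (s := Finset.univ) fun i _ => h1 i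
  have h3 : (fun ω => inner ℝ u (WithLp.toLp 2 (fun i => e i ω)))
      = fun ω => ∑ i, u i * e i ω := by
    funext ω
    simp [PiLp.inner_apply, mul_comm]
  rw [h3]
  refine ⟨h2.integrable_exp_mul, fun t => (h2.mgf_le t).trans (Real.exp_le_exp.2 ?_)⟩
  have h4 : ∑ i, u i ^ 2 ≤ 1 := by
    have := EuclideanSpace.real_norm_sq_eq u
    rw [← this]
    nlinarith [norm_nonneg u]
  push_cast
  rw [← Finset.sum_mul]
  gcongr
  nlinarith [sq_nonneg ((σ.toNNReal : ℝ))]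

/-! ### Effective dimension -/

/-- Comparison with ∫ x^{-α} over [K, K+n]; the shift by K keeps the integral away from 0. -/
lemma sum_shifted_rpow_neg_le {α K : ℝ} (hα : 1 < α) (hK : 0 < K) (n : ℕ) :
    ∑ k : Fin n, (2 * K) ^ α * (K + (((k : ℕ) : ℝ) + 1)) ^ (-α) ≤ 2 ^ α / (α - 1) * K := by
  have h1 : AntitoneOn (fun x : ℝ => x ^ (-α)) (Set.Icc K (K + (n : ℕ))) := fun x hx y _ hxy =>
    Real.rpow_le_rpow_of_nonpos (hK.trans_le hx.1) hxy (by linarith)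
  have h2 := h1.sum_le_integral
  rw [integral_rpow (Or.inr ⟨by linarith, by
    rw [Set.uIcc_of_le (by simp)]; exact fun h => absurd h.1 (not_le.2 hK)⟩)] at h2
  have h3 : ((K + n) ^ (-α + 1) - K ^ (-α + 1)) / (-α + 1) ≤ K ^ (1 - α) / (α - 1) := by
    rw [show -α + 1 = -(α - 1) by ring, show 1 - α = -(α - 1) by ring, div_neg,
      ← neg_div]
    have : 0 ≤ (K + n) ^ (-(α - 1)) := by positivity
    exact div_le_div_of_nonneg_right (by linarith) (by linarith)
  rw [Fin.sum_univ_eq_sum_range (fun k => (2 * K) ^ α * (K + ((k : ℝ) + 1)) ^ (-α)),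
    ← Finset.mul_sum]
  calc _ ≤ (2 * K) ^ α * (K ^ (1 - α) / (α - 1)) := by
        gcongr
        refine le_trans (le_of_eq ?_) (h2.trans h3)
        simp
    _ = _ := by
        rw [Real.mul_rpow (by norm_num) hK.le, Real.rpow_sub hK, Real.rpow_one]
        field_simp

/-- K is the crossover index where C₀ j^{-α} = λ. The single majorant (2K/(K+j))^α dominates 1
before it and (K/j)^α after it. -/
lemma ratio_le_shifted_rpow {α K C₀ lam r j : ℝ} (hα : 0 < α) (hK : 0 < K) (hlam : 0 < lam)
    (hKα : lam * K ^ α = C₀) (hj : 0 < j) (hr : 0 ≤ r) (hrj : r ≤ C₀ * j ^ (-α)) :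
    r / (r + lam) ≤ (2 * K) ^ α * (K + j) ^ (-α) := by
  rw [Real.rpow_neg (by positivity), ← div_eq_mul_inv, ← Real.div_rpow (by positivity)
    (by positivity)]
  rcases le_total j K with h | h
  · have h1 : 1 ≤ 2 * K / (K + j) := by rw [one_le_div (by positivity)]; linarith
    refine le_trans ?_ (Real.one_le_rpow h1 hα.le)
    rw [div_le_one (by positivity)]; linarith
  · calc r / (r + lam) ≤ r / lam := by gcongr; linarith
      _ ≤ C₀ * j ^ (-α) / lam := by gcongr
      _ = (K / j) ^ α := by
        rw [← hKα, Real.rpow_neg hj.le, Real.div_rpow hK.le hj.le]; field_simp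
      _ ≤ _ := by
        refine Real.rpow_le_rpow (by positivity) ?_ hα.le
        rw [div_le_div_iff₀ hj (by positivity)]
        nlinarith

/-! ### Noise and bias -/

/-- One coordinate of the error, with p = √ρ_k and l = √λ. Both filter factors follow from p l ≤ p²
+ l². -/
lemma mul_sq_le_of_filter_eq {p l X s y : ℝ} (hp : 0 ≤ p) (hl : 0 < l)
    (h : (p ^ 2 + l ^ 2) * y = p * X - l ^ 2 * s) :
    p * y ^ 2 ≤ 2 * (l⁻¹ * (p ^ 2 / (p ^ 2 + l ^ 2)) * X ^ 2) + 2 * (l * s ^ 2) := by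
  have hD : 0 < p ^ 2 + l ^ 2 := by positivity
  have hy : y = (p * X - l ^ 2 * s) / (p ^ 2 + l ^ 2) := by field_simp; linarith
  have hpl : p * l ≤ p ^ 2 + l ^ 2 := by nlinarith [sq_nonneg (p - l)]
  have h1 : p * p ^ 2 / (p ^ 2 + l ^ 2) ^ 2 ≤ l⁻¹ * (p ^ 2 / (p ^ 2 + l ^ 2)) := by
    rw [inv_mul_eq_div, div_div, div_le_div_iff₀ (by positivity) (by positivity)]
    calc _ = p ^ 2 * (p ^ 2 + l ^ 2) * (p * l) := by ring
      _ ≤ p ^ 2 * (p ^ 2 + l ^ 2) * (p ^ 2 + l ^ 2) := by gcongr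
      _ = _ := by ring
  have h2 : p * l ^ 4 / (p ^ 2 + l ^ 2) ^ 2 ≤ l := by
    rw [div_le_iff₀ (by positivity)]
    calc _ = l * ((p * l) * l ^ 2) := by ring
      _ ≤ l * ((p ^ 2 + l ^ 2) * (p ^ 2 + l ^ 2)) := by gcongr; nlinarith
      _ = _ := by ring
  calc p * y ^ 2 = p * (p * X - l ^ 2 * s) ^ 2 / (p ^ 2 + l ^ 2) ^ 2 := by
        rw [hy, div_pow, mul_div_assoc]
    _ ≤ p * (2 * (p * X) ^ 2 + 2 * (l ^ 2 * s) ^ 2) / (p ^ 2 + l ^ 2) ^ 2 := by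
        gcongr
        nlinarith [sq_nonneg (p * X + l ^ 2 * s)]
    _ = 2 * (p * p ^ 2 / (p ^ 2 + l ^ 2) ^ 2 * X ^ 2)
        + 2 * (p * l ^ 4 / (p ^ 2 + l ^ 2) ^ 2 * s ^ 2) := by ring
    _ ≤ _ := by gcongr

/-- Splitting of the error of a Tikhonov solution into a quadratic form of the noise and a bias. -/
theorem exists_error_bound {n : ℕ} {A W : Matrix (Fin n) (Fin n) ℝ} (hW : W.PosDef)
    {lam : ℝ} (hlam : 0 < lam) :
    ∃ (ρ : Fin n → ℝ) (u : Fin n → Vec n), IsGenEigenvalues A W ρ ∧ (∀ k, 0 ≤ ρ k) ∧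
      (∀ k, ‖u k‖ ≤ 1) ∧
      ∀ xs e xl : Vec n, IsTikhonovSolution A W (app A xs + e) lam xl →
        ‖app (weakOp A W) (xl - xs)‖ ^ 2
          ≤ 2 * ∑ k, (√lam)⁻¹ * (ρ k / (ρ k + lam)) * inner ℝ (u k) e ^ 2
            + 2 * (√lam * wNorm W xs ^ 2) := by
  obtain ⟨ρ, ψ, hgenE, hρ, hgen, hψ1, hnorm, hweak⟩ := exists_genEigenbasis A W hW
  have hAψ : ∀ k, ‖app A (ψ k)‖ ^ 2 = ρ k := fun k => by
    rw [← real_inner_self_eq_norm_sq, hgen, hψ1, mul_one]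
  have hAψ' : ∀ k, ‖app A (ψ k)‖ = √(ρ k) := fun k => by
    rw [← hAψ k, Real.sqrt_sq (norm_nonneg _)]
  -- Unit vectors, except that they vanish when `ρ k = 0`, since then the inverse is 0; hence only
  -- norm ≤ 1.
  refine ⟨ρ, fun k => (√(ρ k))⁻¹ • app A (ψ k), hgenE, hρ, fun k => ?_, fun xs e xl hxl => ?_⟩
  · rw [norm_smul, hAψ', Real.norm_of_nonneg (by positivity)]
    exact inv_mul_le_one
  rw [hweak, hnorm, Finset.mul_sum, Finset.mul_sum, Finset.mul_sum, ← Finset.sum_add_distrib]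
  refine Finset.sum_le_sum fun k _ => ?_
  have heq := hxl.euler hW (ψ k)
  have hW_sub : wInner W (ψ k) xl = wInner W (ψ k) (xl - xs) + wInner W (ψ k) xs := by
    simp only [wInner, app_sub, inner_sub_right]; ring
  have hA_sub : app A xl - (app A xs + e) = app A (xl - xs) - e := by rw [app_sub]; abel
  rw [hA_sub, inner_sub_right, hgen, hW_sub] at heq
  have hu : inner ℝ (app A (ψ k)) e = √(ρ k) * inner ℝ ((√(ρ k))⁻¹ • app A (ψ k)) e := by
    rcases (hρ k).eq_or_lt with h0 | h0
    · have : app A (ψ k) = 0 := by rw [← norm_eq_zero, hAψ', ← h0, Real.sqrt_zero]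
      simp [this]
    · rw [inner_smul_left, conj_trivial, ← mul_assoc,
        mul_inv_cancel₀ (Real.sqrt_pos.2 h0).ne', one_mul]
  have := mul_sq_le_of_filter_eq (p := √(ρ k)) (l := √lam)
    (X := inner ℝ ((√(ρ k))⁻¹ • app A (ψ k)) e) (s := wInner W (ψ k) xs)
    (y := wInner W (ψ k) (xl - xs)) (Real.sqrt_nonneg _) (Real.sqrt_pos.2 hlam) (by
      rw [← hu, Real.sq_sqrt (hρ k), Real.sq_sqrt hlam.le]; linarith)
  rw [Real.sq_sqrt (hρ k), Real.sq_sqrt hlam.le] at this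
  rw [← Real.sqrt_eq_rpow]
  exact this

lemma rhoZero_pos {n : ℕ} (hn : 0 < n) (W : Matrix (Fin n) (Fin n) ℝ) (xs : Vec n) {σ : ℝ}
    (hσ : 0 < σ) : 0 < rhoZero W xs σ := by
  have : 0 ≤ wNorm W xs := Real.sqrt_nonneg _
  unfold rhoZero
  positivity

lemma wNorm_sq_le {n : ℕ} (hn : 0 < n) (W : Matrix (Fin n) (Fin n) ℝ) (xs : Vec n) {σ : ℝ}
    (hσ : 0 < σ) : wNorm W xs ^ 2 ≤ n * rhoZero W xs σ ^ 2 := by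
  have h0 : 0 ≤ wNorm W xs := Real.sqrt_nonneg _
  have hn' : (0 : ℝ) < n := by exact_mod_cast hn
  have h1 : 1 / √n * wNorm W xs ≤ rhoZero W xs σ := by
    unfold rhoZero
    have : 0 ≤ σ * (n : ℝ) ^ (-(1 / 2) : ℝ) := by positivity
    linarith
  calc wNorm W xs ^ 2 = (√n) ^ 2 * (1 / √n * wNorm W xs) ^ 2 := by field_simp
    _ ≤ n * rhoZero W xs σ ^ 2 := by rw [Real.sq_sqrt hn'.le]; gcongr

end WTikhonov

/-! ### Main theorem -/

open WTikhonov in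
theorem mainTheorem4 (α C₀ c₁ c₂ : ℝ) (hα : 1 < α) (hC₀ : 0 < C₀) (hc₁ : 0 < c₁) (hc₂ : 0 < c₂) :
    ∃ C : ℝ, 0 < C ∧
      ∀ (n : ℕ), 0 < n →
      ∀ (A W : Matrix (Fin n) (Fin n) ℝ), W.PosDef → WTikhonov.EigenvalueDecay A W C₀ α →
      ∀ (xs : WTikhonov.Vec n) (σ lam : ℝ), 0 < σ → 0 < lam →
        c₁ * (σ * (n : ℝ) ^ (-(1 / 2) : ℝ) * (WTikhonov.rhoZero W xs σ)⁻¹)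
            ≤ lam ^ (1 / 2 + 1 / (2 * α)) →
        lam ^ (1 / 2 + 1 / (2 * α))
            ≤ c₂ * (σ * (n : ℝ) ^ (-(1 / 2) : ℝ) * (WTikhonov.rhoZero W xs σ)⁻¹) →
      ∀ (Ω : Type*) [MeasurableSpace Ω] (P : MeasureTheory.Measure Ω)
        [MeasureTheory.IsProbabilityMeasure P] (e : Fin n → Ω → ℝ),
        WTikhonov.IsSubGaussianNoise P e σ →
      ∀ xl : Ω → WTikhonov.Vec n,
        (∀ ω, WTikhonov.IsTikhonovSolution A W
          (WTikhonov.app A xs + WithLp.toLp 2 (fun i => e i ω)) lam (xl ω)) →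
      ∀ z : ℝ, 0 ≤ z →
        P.real {ω | lam ^ (1 / 4 : ℝ) * WTikhonov.rhoZero W xs σ * z
            ≤ 1 / Real.sqrt n * ‖WTikhonov.app (WTikhonov.weakOp A W) (xl ω - xs)‖}
          ≤ 2 * Real.exp (-(C * z ^ 2)) := by
  have hα0 : 0 < α := by linarith
  have hα1 : 0 < α - 1 := by linarith
  set S : ℝ := 2 ^ α / (α - 1) * C₀ ^ (1 / α) with hS
  have hS0 : 0 < S := by positivity
  -- The first entry makes the claim trivial for z ≤ 2, as then 2exp(-Cz²) ≥ 1; the second is the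
  -- rate for z ≥ 2.
  refine ⟨min (Real.log 2 / 4) (c₁ ^ 2 / (16 * S)), lt_min (by positivity) (by positivity), ?_⟩
  intro n hn A W hW hdecay xs σ lam hσ hlam hlow _ Ω _ P _ e he xl hxl z hz
  have hn' : (0 : ℝ) < n := by exact_mod_cast hn
  rcases le_total z 2 with hz2 | hz2
  · refine measureReal_le_one.trans ?_
    have h1 : min (Real.log 2 / 4) (c₁ ^ 2 / (16 * S)) * z ^ 2 ≤ Real.log 2 := by
      calc _ ≤ Real.log 2 / 4 * 2 ^ 2 := by gcongr; exact min_le_left _ _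
        _ = _ := by ring
    calc (1 : ℝ) = 2 * Real.exp (-Real.log 2) := by
          rw [Real.exp_neg, Real.exp_log two_pos]; norm_num
      _ ≤ _ := by gcongr
  obtain ⟨ρ, u, hρE, hρ0, hu, herr⟩ := exists_error_bound (A := A) hW hlam
  set R := rhoZero W xs σ with hR
  have hR0 : 0 < R := rhoZero_pos hn W xs hσ
  set l := √lam with hl
  have hl0 : 0 < l := Real.sqrt_pos.2 hlam
  set Λ : ℝ := lam ^ (1 / α) with hΛ
  have hΛ0 : 0 < Λ := by positivity
  set K : ℝ := (C₀ / lam) ^ (1 / α) with hK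
  have hK0 : 0 < K := by positivity
  have hKα : lam * K ^ α = C₀ := by
    rw [hK, ← Real.rpow_mul (by positivity), one_div_mul_cancel hα0.ne', Real.rpow_one]
    field_simp
  have hSK : 2 ^ α / (α - 1) * K = S / Λ := by
    rw [hK, Real.div_rpow hC₀.le hlam.le, hS]; ring
  -- These majorants stay positive even if every ρ_k is 0, so the tail bound can divide by their
  -- sum.
  let w : Fin n → ℝ := fun k => l⁻¹ * ((2 * K) ^ α * (K + (((k : ℕ) : ℝ) + 1)) ^ (-α))
  have hw0 : ∀ k, 0 < w k := fun k => by positivity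
  have hwsum0 : 0 < ∑ k, w k := Finset.sum_pos (fun k _ => hw0 k) ⟨⟨0, hn⟩, Finset.mem_univ _⟩
  have hwsum : ∑ k, w k ≤ l⁻¹ * (S / Λ) := by
    rw [← Finset.mul_sum, ← hSK]
    exact mul_le_mul_of_nonneg_left (sum_shifted_rpow_neg_le hα hK0 n) (by positivity)
  have hρw : ∀ k, l⁻¹ * (ρ k / (ρ k + lam)) ≤ w k := fun k =>
    mul_le_mul_of_nonneg_left (ratio_le_shifted_rpow hα0 hK0 hlam hKα (by positivity) (hρ0 k)
      (hdecay ρ hρE k)) (by positivity)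
  let X : Fin n → Ω → ℝ := fun k ω => inner ℝ (u k) (WithLp.toLp 2 (fun i => e i ω))
  have hXm : ∀ k, Measurable (X k) := fun k => by
    have := he.measurable
    simp only [X, PiLp.inner_apply]
    fun_prop
  -- On the event, 2Q ≥ n l R²(z² - 2), and z² ≥ 4 makes this at least n l R² z²/2.
  have htail := measureReal_sum_sq_ge_le hXm hσ (fun k => he.hasSubgaussianMGF_inner (u k) (hu k))
    (fun k => (hw0 k).le) hwsum0 (n * l * R ^ 2 * z ^ 2 / 4)
  refine le_trans (measureReal_mono fun ω hω => ?_) (htail.trans ?_)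
  · have hω' : lam ^ (1 / 4 : ℝ) * R * z
        ≤ 1 / √n * ‖app (weakOp A W) (xl ω - xs)‖ := hω
    have hsq := pow_le_pow_left₀ (by positivity) hω' 2
    have hl4 : (lam ^ (1 / 4 : ℝ)) ^ 2 = l := by
      rw [hl, Real.sqrt_eq_rpow, ← Real.rpow_natCast, ← Real.rpow_mul hlam.le]
      norm_num
    rw [mul_pow, mul_pow, mul_pow, hl4, div_pow, one_pow, Real.sq_sqrt hn'.le, one_div,
      inv_mul_eq_div, le_div_iff₀ hn'] at hsq
    have hb := herr xs _ (xl ω) (hxl ω)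
    have hx := mul_le_mul_of_nonneg_left (wNorm_sq_le hn W xs hσ) hl0.le
    have hQ : ∑ k, l⁻¹ * (ρ k / (ρ k + lam)) * X k ω ^ 2 ≤ ∑ k, w k * X k ω ^ 2 :=
      Finset.sum_le_sum fun k _ => mul_le_mul_of_nonneg_right (hρw k) (sq_nonneg _)
    have hz4 : 4 * (n * l * R ^ 2) ≤ z ^ 2 * (n * l * R ^ 2) := by
      gcongr; nlinarith
    simp only [X] at hQ
    change n * l * R ^ 2 * z ^ 2 / 4 ≤ ∑ k, w k * X k ω ^ 2
    simp only [X]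
    linarith
  · gcongr
    refine (mul_le_mul_of_nonneg_right (min_le_right _ _) (sq_nonneg z)).trans ?_
    -- The square of the lower bound on λ, as l²Λ = λ^{1+1/α}.
    have hc : c₁ ^ 2 * σ ^ 2 ≤ n * R ^ 2 * (l ^ 2 * Λ) := by
      have h1 := pow_le_pow_left₀ (by positivity) hlow 2
      have h2 : (lam ^ (1 / 2 + 1 / (2 * α))) ^ 2 = l ^ 2 * Λ := by
        rw [hl, Real.sq_sqrt hlam.le, hΛ, ← Real.rpow_natCast, ← Real.rpow_mul hlam.le]
        conv_rhs => rw [← Real.rpow_one lam, ← Real.rpow_mul hlam.le, ← Real.rpow_add hlam]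
        congr 1
        push_cast
        field_simp
      have h3 : ((n : ℝ) ^ (-(1 / 2) : ℝ)) ^ 2 = (n : ℝ)⁻¹ := by
        rw [← Real.rpow_natCast, ← Real.rpow_mul hn'.le, ← Real.rpow_neg_one]
        norm_num
      rw [h2, mul_pow, mul_pow, mul_pow, h3] at h1
      calc c₁ ^ 2 * σ ^ 2 = n * R ^ 2 * (c₁ ^ 2 * (σ ^ 2 * (n : ℝ)⁻¹ * R⁻¹ ^ 2)) := by
            field_simp
        _ ≤ _ := by gcongr
    rw [div_mul_eq_mul_div, div_le_div_iff₀ (by positivity) (by positivity)]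
    calc c₁ ^ 2 * z ^ 2 * (4 * σ ^ 2 * ∑ k, w k)
        = 4 * z ^ 2 * (c₁ ^ 2 * σ ^ 2) * ∑ k, w k := by ring
      _ ≤ 4 * z ^ 2 * (n * R ^ 2 * (l ^ 2 * Λ)) * (l⁻¹ * (S / Λ)) := by gcongr
      _ = n * l * R ^ 2 * z ^ 2 / 4 * (16 * S) := by field_simp; ring
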